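/- **Setting.** Let $(\mathfrak A_1,\theta_1)$ and $(\mathfrak A_2,\theta_2)$ be unital $\mathbb Z_2$-graded $C^*$-algebras, i.e. unital $C^*$-algebras with $*$-automorphisms $\theta_i$ such that $\theta_i^2=\mathrm{id}$; write $\mathfrak A_{i,\pm}=\{a:\theta_i(a)=\pm a\}$ for the even and odd parts. The algebraic Fermi product $\mathfrak A_1\,ⓕ\,\mathfrak A_2$ is the vector space $\mathfrak A_1\odot\mathfrak A_2$ with the product and involution determined on homogeneous elements by $$(a_1\otimes a_2)(b_1\otimes b_2)=\varepsilon(a_2,b_1)\,a_1b_1\otimes a_2b_2,\qquad (a_1\otimes a_2)^*=\varepsilon(a_1,a_2)\,a_1^*\otimes a_2^*,$$ where $\varepsilon(x,y)=-1$ if $x$ and $y$ are both odd and $\varepsilon(x,y)=1$ otherwise. Its product grading is the involutive $*$-automorphism $\theta=\theta_1\,ⓕ\,\theta_2$ with $\theta(a_1\otimes a_2)=\theta_1(a_1)\otimes\theta_2(a_2)$. A state $\omega$ of $\mathfrak A_i$ is even if $\omega\circ\theta_i=\omega$. For even states $\omega_1,\omega_2$ let $\omega_1\times\omega_2$ be the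 functional on $\mathfrak A_1\,ⓕ\,\mathfrak A_2$ with $(\omega_1\times\omega_2)(a_1\otimes a_2)=\omega_1(a_1)\omega_2(a_2)$, and let $(\mathcal H,\pi_{\omega_1\times\omega_2},\xi)$ be its GNS representation: a $*$-representation by bounded operators on a Hilbert space with a cyclic vector $\xi$ such that $\langle\xi,\pi_{\omega_1\times\omega_2}(x)\xi\rangle=(\omega_1\times\omega_2)(x)$ for all $x$. For $x\in\mathfrak A_1\,ⓕ\,\mathfrak A_2$ put $$\|x\|_{\max}=\sup\{\|\pi(x)\|:\pi\text{ a $*$-representation of }\mathfrak A_1\,ⓕ\,\mathfrak A_2\text{ by bounded operators on a Hilbert space}\},$$ $$\|x\|_{\min}=\sup\{\|\pi_{\omega_1\times\omega_2}(x)\|:\omega_1,\omega_2\text{ even states of }\mathfrak A_1,\mathfrak A_2\}.$$ A $C^*$-norm on $\mathfrak A_1\,ⓕ\,\mathfrak A_2$ is called compatible if $\theta$ extends to an involutive $*$-automorphism of the completion of $\mathfrak A_1\,ⓕ\,\mathfrak A_2$ in that norm. **Proposition.** The maximal norm $\|\cdot\|_{\max}$ and the spatial norm $\|\cdot\|_{\min}$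 are compatible: each of them is a $C^*$-norm on $\mathfrak A_1\,ⓕ\,\mathfrak A_2$, and $\theta_1\,ⓕ\,\theta_2$ extends to an involutive $*$-automorphism of the corresponding completion. Moreover, for all even states $\omega_1$ of $\mathfrak A_1$ and $\omega_2$ of $\mathfrak A_2$, the GNS representation of $\omega_1\times\omega_2$ exists, and in every such representation the grading is unitarily implemented: there is a self-adjoint unitary $V$ on $\mathcal H$ with $V\xi=\xi$ and $$\pi_{\omega_1\times\omega_2}(\theta(x))=V\,\pi_{\omega_1\times\omega_2}(x)\,V\qquad\text{for all }x\in\mathfrak A_1\,ⓕ\,\mathfrak A_2 .$$ -/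

import Mathlib

open scoped TensorProduct ComplexOrder

universe u v w

noncomputable section

namespace FermiTensor


/-! ### `ℤ/2`-graded unital `*`-algebras -/

/-- A `ℤ/2`-grading of a unital complex `*`-algebra: an involutive `*`-automorphism. -/
structure Z2Grading (A : Type u) [Ring A] [StarRing A] [Algebra ℂ A] where
  /-- the underlying `*`-automorphism -/
  aut : A ≃⋆ₐ[ℂ] A
  /-- the automorphism squares to the identity -/
  invol : ∀ a, aut (aut a) = a

theorem zmod_two_cases (i : ZMod 2) : i = 0 ∨ i = 1 := by
  revert i; decide

theorem zmod_two_one_ne : (1 : ZMod 2) ≠ 0 := by decide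

theorem zmod_two_add : (1 + 1 : ZMod 2) = 0 := by decide

namespace Z2Grading

variable {A : Type u} [Ring A] [StarRing A] [Algebra ℂ A] (θ : Z2Grading A)

/-- The homogeneous components: grade `0` is the even part `{a | θ a = a}`, grade `1` is the
odd part `{a | θ a = -a}`. -/
def part (i : ZMod 2) : Submodule ℂ A where
  carrier := {a | θ.aut a = if i = 0 then a else -a}
  add_mem' := by
    intro a b ha hb
    simp only [Set.mem_ofPred_eq, map_add] at *
    rw [ha, hb]; split_ifs <;> abel
  zero_mem' := by simp
  smul_mem' := by
    intro c a ha
    simp only [Set.mem_ofPred_eq, map_smul] at *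
    rw [ha]; split_ifs <;> simp

/-- The projection `(id + θ) / 2` or `(id - θ) / 2` onto the component of grade `i`. -/
def proj (i : ZMod 2) : A →ₗ[ℂ] A :=
  (1 / 2 : ℂ) • (LinearMap.id +
    (if i = 0 then (1 : ℂ) else -1) • θ.aut.toAlgEquiv.toLinearMap)

theorem mem_part_zero {a : A} : a ∈ θ.part 0 ↔ θ.aut a = a := by
  change θ.aut a = (if (0 : ZMod 2) = 0 then a else -a) ↔ _
  simp

theorem mem_part_one {a : A} : a ∈ θ.part 1 ↔ θ.aut a = -a := by
  change θ.aut a = (if (1 : ZMod 2) = 0 then a else -a) ↔ _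
  simp

theorem proj_zero_apply (a : A) : θ.proj 0 a = (1 / 2 : ℂ) • (a + θ.aut a) := by
  simp [proj]

theorem proj_one_apply (a : A) : θ.proj 1 a = (1 / 2 : ℂ) • (a - θ.aut a) := by
  simp [proj, sub_eq_add_neg]

theorem proj_mem (i : ZMod 2) (a : A) : θ.proj i a ∈ θ.part i := by
  rcases zmod_two_cases i with rfl | rfl
  · rw [mem_part_zero, proj_zero_apply, map_smul, map_add, θ.invol, add_comm]
  · rw [mem_part_one, proj_one_apply, map_smul, map_sub, θ.invol, ← smul_neg, neg_sub]

theorem proj_add_proj (a : A) : θ.proj 0 a + θ.proj 1 a = a := by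
  rw [proj_zero_apply, proj_one_apply, ← smul_add, add_add_sub_cancel, ← two_smul ℂ a, smul_smul]
  norm_num

theorem proj_of_mem {i : ZMod 2} {a : A} (ha : a ∈ θ.part i) (j : ZMod 2) :
    θ.proj j a = if j = i then a else 0 := by
  have h2 : (2⁻¹ : ℂ) • (a + a) = a := by
    rw [← two_smul ℂ a, smul_smul]; norm_num
  rcases zmod_two_cases i with rfl | rfl <;> rcases zmod_two_cases j with rfl | rfl
  · have := (θ.mem_part_zero).1 ha
    simp [proj_zero_apply, this, h2]
  · have := (θ.mem_part_zero).1 ha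
    simp [proj_one_apply, this]
  · have := (θ.mem_part_one).1 ha
    simp [proj_zero_apply, this]
  · have := (θ.mem_part_one).1 ha
    simp [proj_one_apply, this, h2]

theorem aut_of_mem {i : ZMod 2} {a : A} (ha : a ∈ θ.part i) :
    θ.aut a = if i = 0 then a else -a := ha

theorem aut_mem {i : ZMod 2} {a : A} (ha : a ∈ θ.part i) : θ.aut a ∈ θ.part i := by
  rw [θ.aut_of_mem ha]
  split_ifs
  · exact ha
  · exact neg_mem ha

theorem star_mem {i : ZMod 2} {a : A} (ha : a ∈ θ.part i) : star a ∈ θ.part i := by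
  have h : θ.aut (star a) = if i = 0 then star a else -star a := by
    rw [map_star, θ.aut_of_mem ha]; split_ifs <;> simp
  exact h

instance : SetLike.GradedMonoid θ.part where
  one_mem := by rw [mem_part_zero, map_one]
  mul_mem := by
    intro i j a b ha hb
    have h : θ.aut (a * b) = if i + j = 0 then a * b else -(a * b) := by
      rw [map_mul, θ.aut_of_mem ha, θ.aut_of_mem hb]
      rcases zmod_two_cases i with rfl | rfl <;> rcases zmod_two_cases j with rfl | rfl <;>
        simp [zmod_two_add]
    exact h

instance : GradedAlgebra θ.part where
  decompose' a := ∑ i, DirectSum.of (fun i => θ.part i) i ⟨θ.proj i a, θ.proj_mem i a⟩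
  left_inv a := by
    rw [map_sum]
    simp only [DirectSum.coeAddMonoidHom_of]
    exact (Fin.sum_univ_two _).trans (θ.proj_add_proj a)
  right_inv x := by
    induction x using DirectSum.induction_on with
    | zero =>
      refine Finset.sum_eq_zero fun i _ => ?_
      rw [← map_zero (DirectSum.of (fun i => θ.part i) i)]
      congr 1
      ext
      simp
    | of i a =>
      rw [DirectSum.coeAddMonoidHom_of]
      refine (Finset.sum_eq_single i ?_ ?_).trans ?_
      · intro j _ hj
        rw [← map_zero (DirectSum.of (fun i => θ.part i) j)]
        congr 1
        ext
        simp [θ.proj_of_mem a.2, hj]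
      · simp
      · congr 1
        ext
        simp [θ.proj_of_mem a.2]
    | add x y hx hy =>
      conv_rhs => rw [← hx, ← hy]
      rw [← Finset.sum_add_distrib]
      refine Finset.sum_congr rfl fun i _ => ?_
      rw [← map_add]
      congr 1
      ext
      simp

end Z2Grading

/-! ### The Fermi product -/

section Fermi

variable {A₁ : Type u} {A₂ : Type v} [Ring A₁] [StarRing A₁] [Algebra ℂ A₁]
  [Ring A₂] [StarRing A₂] [Algebra ℂ A₂]

/-- The algebraic Fermi product: the vector space `A₁ ⊗ A₂` with the multiplication
`(a ⊗ b) (c ⊗ d) = (-1) ^ (∂b ∂c) (a c) ⊗ (b d)` for homogeneous `b`, `c`. -/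
abbrev Fermi (θ₁ : Z2Grading A₁) (θ₂ : Z2Grading A₂) : Type (max u v) :=
  GradedTensorProduct ℂ θ₁.part θ₂.part

variable (θ₁ : Z2Grading A₁) (θ₂ : Z2Grading A₂)

/-- The elementary tensor `a ⊗ b` in the Fermi product. -/
abbrev ftmul (a : A₁) (b : A₂) : Fermi θ₁ θ₂ :=
  GradedTensorProduct.of ℂ θ₁.part θ₂.part (a ⊗ₜ[ℂ] b)

variable {θ₁ θ₂} in
theorem fermi_induction {P : Fermi θ₁ θ₂ → Prop} (x : Fermi θ₁ θ₂) (zero : P 0)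
    (tmul : ∀ (i j : ZMod 2) (a : A₁) (b : A₂), a ∈ θ₁.part i → b ∈ θ₂.part j →
      P (ftmul θ₁ θ₂ a b))
    (add : ∀ x y, P x → P y → P (x + y)) : P x := by
  obtain ⟨y, rfl⟩ := (GradedTensorProduct.of ℂ θ₁.part θ₂.part).surjective x
  induction y using TensorProduct.induction_on with
  | zero => simpa using zero
  | add y z hy hz => rw [map_add]; exact add _ _ hy hz
  | tmul a b =>
    rw [← θ₁.proj_add_proj a, ← θ₂.proj_add_proj b]
    simp only [TensorProduct.add_tmul, TensorProduct.tmul_add, map_add]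
    exact add _ _
      (add _ _ (tmul 0 0 _ _ (θ₁.proj_mem _ _) (θ₂.proj_mem _ _))
        (tmul 1 0 _ _ (θ₁.proj_mem _ _) (θ₂.proj_mem _ _)))
      (add _ _ (tmul 0 1 _ _ (θ₁.proj_mem _ _) (θ₂.proj_mem _ _))
        (tmul 1 1 _ _ (θ₁.proj_mem _ _) (θ₂.proj_mem _ _)))

/-- The sign `-1` if both grades are odd, and `1` otherwise. -/
def sgn (i j : ZMod 2) : ℂ := if i = 1 ∧ j = 1 then -1 else 1

variable {θ₁ θ₂} in
theorem ftmul_mul_ftmul {i j k l : ZMod 2} {a : A₁} {b : A₂} {c : A₁} {d : A₂}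
    (_ : a ∈ θ₁.part i) (hb : b ∈ θ₂.part j) (hc : c ∈ θ₁.part k) (_ : d ∈ θ₂.part l) :
    ftmul θ₁ θ₂ a b * ftmul θ₁ θ₂ c d = sgn j k • ftmul θ₁ θ₂ (a * c) (b * d) := by
  have h := GradedTensorProduct.tmul_coe_mul_coe_tmul (R := ℂ) θ₁.part θ₂.part a
    (⟨b, hb⟩ : θ₂.part j) (⟨c, hc⟩ : θ₁.part k) d
  refine h.trans ?_
  rcases zmod_two_cases j with rfl | rfl <;> rcases zmod_two_cases k with rfl | rfl <;>
    simp [sgn]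

variable [StarModule ℂ A₁] [StarModule ℂ A₂]

/-- The involution of the Fermi product: `x* = ∑ ε(i, j) (x_{i,j})*`, where `x_{i,j}` is the
component of `x` in `A_{1,i} ⊗ A_{2,j}` and the star on the right-hand side is
`(a ⊗ b)* = a* ⊗ b*`. -/
instance : Star (Fermi θ₁ θ₂) where
  star x := ∑ i : ZMod 2, ∑ j : ZMod 2, sgn i j • GradedTensorProduct.of ℂ θ₁.part θ₂.part
    (star (TensorProduct.map (θ₁.proj i) (θ₂.proj j)
      ((GradedTensorProduct.of ℂ θ₁.part θ₂.part).symm x)))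

theorem fermi_star_def (x : Fermi θ₁ θ₂) :
    star x = ∑ i : ZMod 2, ∑ j : ZMod 2, sgn i j • GradedTensorProduct.of ℂ θ₁.part θ₂.part
      (star (TensorProduct.map (θ₁.proj i) (θ₂.proj j)
        ((GradedTensorProduct.of ℂ θ₁.part θ₂.part).symm x))) := rfl

theorem fermi_star_add (x y : Fermi θ₁ θ₂) : star (x + y) = star x + star y := by
  simp only [fermi_star_def, map_add, star_add, smul_add, Finset.sum_add_distrib]

theorem fermi_star_smul (c : ℂ) (x : Fermi θ₁ θ₂) : star (c • x) = star c • star x := by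
  simp only [fermi_star_def, map_smul, star_smul, Finset.smul_sum]
  refine Finset.sum_congr rfl fun i _ => Finset.sum_congr rfl fun j _ => smul_comm _ _ _

theorem fermi_star_zero : star (0 : Fermi θ₁ θ₂) = 0 := by
  simpa using fermi_star_smul θ₁ θ₂ 0 0

variable {θ₁ θ₂} in
theorem star_ftmul {i j : ZMod 2} {a : A₁} {b : A₂} (ha : a ∈ θ₁.part i) (hb : b ∈ θ₂.part j) :
    star (ftmul θ₁ θ₂ a b) = sgn i j • ftmul θ₁ θ₂ (star a) (star b) := by
  rw [fermi_star_def, Finset.sum_eq_single i, Finset.sum_eq_single j]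
  · simp [θ₁.proj_of_mem ha, θ₂.proj_of_mem hb]
  · intro k _ hk
    simp [θ₂.proj_of_mem hb, hk]
  · simp
  · intro k _ hk
    simp [θ₁.proj_of_mem ha, hk]
  · simp

instance : StarRing (Fermi θ₁ θ₂) where
  star_involutive x := by
    induction x using fermi_induction with
    | zero => simp only [fermi_star_zero]
    | add x y hx hy => rw [fermi_star_add, fermi_star_add, hx, hy]
    | tmul i j a b ha hb =>
      rw [star_ftmul ha hb, fermi_star_smul, star_ftmul (θ₁.star_mem ha) (θ₂.star_mem hb),
        star_star, star_star, smul_smul]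
      rcases zmod_two_cases i with rfl | rfl <;> rcases zmod_two_cases j with rfl | rfl <;>
        simp [sgn]
  star_add := fermi_star_add θ₁ θ₂
  star_mul x y := by
    induction x using fermi_induction with
    | zero => simp only [zero_mul, mul_zero, fermi_star_zero]
    | add x x' hx hx' => simp only [add_mul, mul_add, fermi_star_add, hx, hx']
    | tmul i j a b ha hb =>
      induction y using fermi_induction with
      | zero => simp only [zero_mul, mul_zero, fermi_star_zero]
      | add x x' hx hx' => simp only [add_mul, mul_add, fermi_star_add, hx, hx']
      | tmul k l c d hc hd =>
        rw [ftmul_mul_ftmul ha hb hc hd, fermi_star_smul, star_ftmul ha hb, star_ftmul hc hd,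
          star_ftmul (SetLike.mul_mem_graded ha hc) (SetLike.mul_mem_graded hb hd),
          smul_mul_assoc, mul_smul_comm,
          ftmul_mul_ftmul (θ₁.star_mem hc) (θ₂.star_mem hd) (θ₁.star_mem ha) (θ₂.star_mem hb),
          star_mul, star_mul, smul_smul, smul_smul, smul_smul]
        congr 1
        rcases zmod_two_cases i with rfl | rfl <;> rcases zmod_two_cases j with rfl | rfl <;>
          rcases zmod_two_cases k with rfl | rfl <;> rcases zmod_two_cases l with rfl | rfl <;>
          simp [sgn, zmod_two_add]

instance : StarModule ℂ (Fermi θ₁ θ₂) := ⟨fermi_star_smul θ₁ θ₂⟩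

/-- The product grading `θ₁ ⓕ θ₂` of the Fermi product, `a ⊗ b ↦ θ₁ a ⊗ θ₂ b`. -/
def prodGrading : Z2Grading (Fermi θ₁ θ₂) :=
  let T : Fermi θ₁ θ₂ →ₗ[ℂ] Fermi θ₁ θ₂ :=
    (GradedTensorProduct.of ℂ θ₁.part θ₂.part).toLinearMap ∘ₗ
      TensorProduct.map θ₁.aut.toAlgEquiv.toLinearMap θ₂.aut.toAlgEquiv.toLinearMap ∘ₗ
      (GradedTensorProduct.of ℂ θ₁.part θ₂.part).symm.toLinearMap
  have hT : ∀ a b, T (ftmul θ₁ θ₂ a b) = ftmul θ₁ θ₂ (θ₁.aut a) (θ₂.aut b) := fun a b => rfl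
  have hinv : ∀ x, T (T x) = x := fun x => by
    induction x using fermi_induction with
    | zero => simp only [map_zero]
    | add x y hx hy => simp only [map_add, hx, hy]
    | tmul i j a b ha hb => rw [hT, hT, θ₁.invol, θ₂.invol]
  { aut :=
      { toFun := T
        invFun := T
        left_inv := hinv
        right_inv := hinv
        map_add' := map_add T
        map_smul' := map_smul T
        map_star' := fun x => by
          induction x using fermi_induction with
          | zero => simp only [star_zero, map_zero]
          | add x y hx hy => simp only [star_add, map_add, hx, hy]
          | tmul i j a b ha hb =>
            rw [star_ftmul ha hb, map_smul, hT, hT, star_ftmul (θ₁.aut_mem ha) (θ₂.aut_mem hb),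
              map_star, map_star]
        map_mul' := fun x y => by
          induction x using fermi_induction with
          | zero => simp only [zero_mul, map_zero]
          | add x x' hx hx' => simp only [add_mul, map_add, hx, hx']
          | tmul i j a b ha hb =>
            induction y using fermi_induction with
            | zero => simp only [mul_zero, map_zero]
            | add x x' hx hx' => simp only [mul_add, map_add, hx, hx']
            | tmul k l c d hc hd =>
              rw [ftmul_mul_ftmul ha hb hc hd, map_smul, hT, hT, hT,
                ftmul_mul_ftmul (θ₁.aut_mem ha) (θ₂.aut_mem hb) (θ₁.aut_mem hc) (θ₂.aut_mem hd),
                map_mul, map_mul] }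
    invol := hinv }

theorem prodGrading_ftmul (a : A₁) (b : A₂) :
    (prodGrading θ₁ θ₂).aut (ftmul θ₁ θ₂ a b) = ftmul θ₁ θ₂ (θ₁.aut a) (θ₂.aut b) := rfl

/-- The product functional `(ω₁ × ω₂)(a ⊗ b) = ω₁(a) ω₂(b)` on the Fermi product. -/
def prodFunctional (ω₁ : A₁ →ₗ[ℂ] ℂ) (ω₂ : A₂ →ₗ[ℂ] ℂ) : Fermi θ₁ θ₂ →ₗ[ℂ] ℂ :=
  LinearMap.mul' ℂ ℂ ∘ₗ TensorProduct.map ω₁ ω₂ ∘ₗ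
    (GradedTensorProduct.of ℂ θ₁.part θ₂.part).symm.toLinearMap

end Fermi

/-! ### States, representations, GNS representations -/

section Reps

variable {A : Type u} [Ring A] [StarRing A] [Algebra ℂ A]

/-- A state of a unital `*`-algebra: a positive unital linear functional. -/
structure IsState (ω : A →ₗ[ℂ] ℂ) : Prop where
  map_one : ω 1 = 1
  nonneg : ∀ a, 0 ≤ ω (star a * a)

/-- An even state: a state with `ω ∘ θ = ω`. -/
structure IsEvenState (θ : Z2Grading A) (ω : A →ₗ[ℂ] ℂ) : Prop extends IsState ω where
  even : ∀ a, ω (θ.aut a) = ω a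

variable (A) in
/-- A (unital) `*`-representation by bounded operators on a complex Hilbert space. -/
structure HilbertRep where
  /-- the Hilbert space -/
  H : Type w
  [normed : NormedAddCommGroup H]
  [innerProduct : InnerProductSpace ℂ H]
  [complete : CompleteSpace H]
  /-- the `*`-homomorphism into the bounded operators -/
  rep : A →⋆ₐ[ℂ] (H →L[ℂ] H)

attribute [instance] HilbertRep.normed HilbertRep.innerProduct HilbertRep.complete

/-- A GNS representation of the functional `φ`: a `*`-representation `π` with a cyclic vector `ξ`
such that `φ(x) = ⟨ξ, π(x) ξ⟩`. It is unique up to unitary equivalence. -/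
structure GNSRep (φ : A →ₗ[ℂ] ℂ) extends HilbertRep.{u, w} A where
  /-- the cyclic vector -/
  vec : H
  cyclic : DenseRange fun x => rep x vec
  inner_vec : ∀ x, Inner.inner ℂ vec (rep x vec) = φ x

end Reps

/-! ### `C*`-norms and completions -/

/-- A `C*`-norm on a unital complex `*`-algebra. -/
structure CStarNorm (A : Type u) [Ring A] [StarRing A] [Algebra ℂ A] extends AlgebraNorm ℂ A where
  star_mul_self' : ∀ a, toFun (star a * a) = toFun a * toFun a

namespace CStarNorm

variable {A : Type u} [Ring A] [StarRing A] [Algebra ℂ A]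

/-- The `*`-algebra `A`, regarded as a normed algebra with the norm `N`. -/
def Carrier (_ : CStarNorm A) : Type u := A

variable (N : CStarNorm A)

instance : NormedRing N.Carrier := N.toAlgebraNorm.toRingNorm.toNormedRing

instance : StarRing N.Carrier := inferInstanceAs (StarRing A)

theorem norm_def (a : N.Carrier) : ‖a‖ = N.toFun a := rfl

instance : CStarRing N.Carrier where
  norm_mul_self_le a := (N.star_mul_self' a).ge

instance : Algebra ℂ N.Carrier := inferInstanceAs (Algebra ℂ A)

instance : NormedAlgebra ℂ N.Carrier where
  norm_smul_le c a := (N.smul' c a).le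

instance [StarModule ℂ A] : StarModule ℂ N.Carrier := inferInstanceAs (StarModule ℂ A)

/-- The completion of `A` with respect to the `C*`-norm `N`. -/
abbrev Completion : Type u := UniformSpace.Completion N.Carrier

/-- The canonical map of `A` into its completion. -/
def toCompletion (a : A) : N.Completion :=
  UniformSpace.Completion.coe' (α := N.Carrier) a

/-- The involution of the completion, extending that of `A` by continuity. -/
instance : Star N.Completion where
  star := UniformSpace.Completion.map (star : N.Carrier → N.Carrier)

theorem uniformContinuous_star : UniformContinuous (star : N.Carrier → N.Carrier) :=
  (starNormedAddGroupHom (E := N.Carrier)).uniformContinuous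

theorem star_coe (a : N.Carrier) :
    star (a : UniformSpace.Completion N.Carrier)
      = ((star a : N.Carrier) : UniformSpace.Completion N.Carrier) :=
  UniformSpace.Completion.map_coe N.uniformContinuous_star a

theorem continuous_star_completion : Continuous (star : N.Completion → N.Completion) :=
  UniformSpace.Completion.continuous_map

instance : StarRing N.Completion where
  star_involutive x := by
    induction x using UniformSpace.Completion.induction_on with
    | hp =>
      exact isClosed_eq (N.continuous_star_completion.comp N.continuous_star_completion)
        continuous_id
    | ih a => rw [star_coe, star_coe, star_star]
  star_mul x y := by
    induction x, y using UniformSpace.Completion.induction_on₂ with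
    | hp =>
      exact isClosed_eq (N.continuous_star_completion.comp (continuous_fst.mul continuous_snd))
        ((N.continuous_star_completion.comp continuous_snd).mul
          (N.continuous_star_completion.comp continuous_fst))
    | ih a b =>
      rw [← UniformSpace.Completion.coe_mul, star_coe, star_coe, star_coe, star_mul,
        UniformSpace.Completion.coe_mul]
  star_add x y := by
    induction x, y using UniformSpace.Completion.induction_on₂ with
    | hp =>
      exact isClosed_eq (N.continuous_star_completion.comp (continuous_fst.add continuous_snd))
        ((N.continuous_star_completion.comp continuous_fst).add
          (N.continuous_star_completion.comp continuous_snd))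
    | ih a b =>
      rw [← UniformSpace.Completion.coe_add, star_coe, star_coe, star_coe, star_add,
        UniformSpace.Completion.coe_add]

instance : CStarRing N.Completion where
  norm_mul_self_le x := by
    induction x using UniformSpace.Completion.induction_on with
    | hp =>
      exact isClosed_le (continuous_norm.mul continuous_norm)
        (continuous_norm.comp (N.continuous_star_completion.mul continuous_id))
    | ih a =>
      rw [star_coe, ← UniformSpace.Completion.coe_mul, UniformSpace.Completion.norm_coe,
        UniformSpace.Completion.norm_coe]
      exact CStarRing.norm_mul_self_le a

instance : NormedAlgebra ℂ N.Completion where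
  norm_smul_le c x := by
    induction x using UniformSpace.Completion.induction_on with
    | hp =>
      exact isClosed_le (continuous_norm.comp (continuous_const_smul c))
        (continuous_const.mul continuous_norm)
    | ih a =>
      rw [← UniformSpace.Completion.coe_smul, UniformSpace.Completion.norm_coe,
        UniformSpace.Completion.norm_coe]
      exact norm_smul_le c a

instance [StarModule ℂ A] : StarModule ℂ N.Completion where
  star_smul c x := by
    induction x using UniformSpace.Completion.induction_on with
    | hp =>
      exact isClosed_eq (N.continuous_star_completion.comp (continuous_const_smul c))
        ((continuous_const_smul (star c)).comp N.continuous_star_completion)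
    | ih a =>
      rw [← UniformSpace.Completion.coe_smul, star_coe, star_coe, star_smul,
        UniformSpace.Completion.coe_smul]

/-- The completion with respect to a `C*`-norm is a `C*`-algebra. -/
instance [StarModule ℂ A] : CStarAlgebra N.Completion where

end CStarNorm

/-! ### The maximal and the spatial norm -/

section Norms

variable {A₁ : Type u} {A₂ : Type v} [Ring A₁] [StarRing A₁] [Algebra ℂ A₁] [StarModule ℂ A₁]
  [Ring A₂] [StarRing A₂] [Algebra ℂ A₂] [StarModule ℂ A₂]
  (θ₁ : Z2Grading A₁) (θ₂ : Z2Grading A₂)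

/-- The maximal norm: the supremum of `‖π(x)‖` over all `*`-representations of the Fermi
product. -/
def maxNorm (x : Fermi θ₁ θ₂) : ℝ :=
  sSup {r | ∃ π : HilbertRep.{max u v, max u v} (Fermi θ₁ θ₂), r = ‖π.rep x‖}

/-- The spatial norm: the supremum of `‖π_{ω₁ × ω₂}(x)‖` over all even states `ω₁`, `ω₂`. -/
def minNorm (x : Fermi θ₁ θ₂) : ℝ :=
  sSup {r | ∃ (ω₁ : A₁ →ₗ[ℂ] ℂ) (ω₂ : A₂ →ₗ[ℂ] ℂ), IsEvenState θ₁ ω₁ ∧ IsEvenState θ₂ ω₂ ∧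
    ∃ π : GNSRep.{max u v, max u v} (prodFunctional θ₁ θ₂ ω₁ ω₂), r = ‖π.rep x‖}

/-- A function `β` on the Fermi product is a compatible norm if it is a `C*`-norm and the product
grading extends to an involutive `*`-automorphism of the completion. -/
def IsCompatible (β : Fermi θ₁ θ₂ → ℝ) : Prop :=
  ∃ N : CStarNorm (Fermi θ₁ θ₂), (∀ x, N.toFun x = β x) ∧
    ∃ Θ : N.Completion ≃⋆ₐ[ℂ] N.Completion, (∀ z, Θ (Θ z) = z) ∧
      ∀ x, Θ (N.toCompletion x) = N.toCompletion ((prodGrading θ₁ θ₂).aut x)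

end Norms

end FermiTensor

end

noncomputable section

namespace FermiTensor

/-! Both norms are suprema of `‖π x‖` over a class of representations. Such a supremum is a
`C*`-norm once the class is pointwise bounded and separates points (`repCStarNorm`). If the class is
also stable under `π ↦ π ∘ θ`, then `θ` is isometric and extends to the completion by continuity
(`isCompatible_repNorm`).

Boundedness holds because the Fermi product is spanned by products of elements from two embedded
`C*`-algebras, on which `*`-homomorphisms are contractive (`exists_norm_rep_le`).

Separation rests on `prodFunctional_star_mul`: evenness of `ω₁` removes every sign, so the
sesquilinear form of `ω₁ × ω₂` is the ordinary tensor product of the two forms. Positivity is then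
the Schur product theorem, and separation reduces to even states separating each factor, which
follows from Hahn-Banach and averaging over the grading.

Since `ω₁ × ω₂` is `θ`-invariant, `π ∘ θ` is a GNS representation of the same functional, and `π(x)ξ
↦ π(θ x)ξ` is isometric on a dense subspace. Its extension is the implementing unitary. -/

/-! ### The GNS construction for positive functionals on `*`-algebras -/

section GNS

variable {B : Type u} [Ring B] [StarRing B] [Algebra ℂ B]

/-- A linear functional on a `*`-algebra is positive if `φ (star a * a) ≥ 0` for all `a`. -/
def IsPositiveFunctional (φ : B →ₗ[ℂ] ℂ) : Prop := ∀ a, 0 ≤ φ (star a * a)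

namespace IsPositiveFunctional

variable [StarModule ℂ B] {φ : B →ₗ[ℂ] ℂ}

/-- Polarization: `φ (star x * x)` is real for `x = a + b` and for `x = a + i b`, which compares the
imaginary and the real parts respectively. -/
theorem conj_apply (hφ : IsPositiveFunctional φ) (a b : B) :
    (starRingEnd ℂ) (φ (star b * a)) = φ (star a * b) := by
  have him : ∀ x, (φ (star x * x)).im = 0 := fun x => ((Complex.nonneg_iff.1 (hφ x)).2).symm
  have h1 := him (a + b)
  have h2 := him (a + Complex.I • b)
  have ha := him a
  have hb := him b
  simp only [star_add, star_smul, add_mul, mul_add, smul_mul_assoc, mul_smul_comm, map_add,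
    map_smul, smul_eq_mul, Complex.add_im, Complex.mul_im, RCLike.star_def, Complex.conj_I,
    Complex.neg_im, Complex.neg_re, Complex.I_re, Complex.I_im, Complex.mul_re] at h1 h2
  apply Complex.ext
  · rw [Complex.conj_re]; linarith
  · rw [Complex.conj_im]; linarith

set_option linter.unusedVariables false in
/-- The `*`-algebra `B` with the semi-inner product `⟪a, b⟫ = φ (star a * b)`. -/
@[nolint unusedArguments]
def PreGNS (hφ : IsPositiveFunctional φ) : Type u := B

variable (hφ : IsPositiveFunctional φ)

instance : AddCommGroup hφ.PreGNS := inferInstanceAs (AddCommGroup B)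
instance : Module ℂ hφ.PreGNS := inferInstanceAs (Module ℂ B)

/-- The identity map from `B` to `PreGNS`. -/
def toPreGNS : B ≃ₗ[ℂ] hφ.PreGNS := LinearEquiv.refl ℂ _

/-- The semi-inner product defined by a positive functional. -/
abbrev preGNSCore : PreInnerProductSpace.Core ℂ hφ.PreGNS where
  inner a b := φ (star (hφ.toPreGNS.symm a) * hφ.toPreGNS.symm b)
  conj_inner_symm a b := hφ.conj_apply _ _
  re_inner_nonneg a := (Complex.nonneg_iff.1 (hφ (hφ.toPreGNS.symm a))).1
  add_left _ _ _ := by rw [map_add, star_add, add_mul, map_add]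
  smul_left := by simp

instance : SeminormedAddCommGroup hφ.PreGNS :=
  InnerProductSpace.Core.toSeminormedAddCommGroup (c := hφ.preGNSCore)

instance : InnerProductSpace ℂ hφ.PreGNS := InnerProductSpace.ofCore hφ.preGNSCore

theorem inner_toPreGNS (a b : B) :
    Inner.inner ℂ (hφ.toPreGNS a) (hφ.toPreGNS b) = φ (star a * b) := rfl

theorem norm_sq_toPreGNS (a : B) : ‖hφ.toPreGNS a‖ ^ 2 = (φ (star a * a)).re := by
  rw [← hφ.inner_toPreGNS, ← inner_self_eq_norm_sq (𝕜 := ℂ)]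
  rfl

/-- Left multiplication by `x` is bounded for the seminorm defined by `φ`. -/
def LeftBounded (x : B) : Prop :=
  ∃ C, ∀ y, ‖hφ.toPreGNS (x * y)‖ ≤ C * ‖hφ.toPreGNS y‖

variable {hφ}

theorem LeftBounded.zero : hφ.LeftBounded 0 := ⟨0, fun y => by simp⟩

theorem LeftBounded.add {x x' : B} (h : hφ.LeftBounded x) (h' : hφ.LeftBounded x') :
    hφ.LeftBounded (x + x') := by
  obtain ⟨C, hC⟩ := h
  obtain ⟨C', hC'⟩ := h'
  refine ⟨C + C', fun y => ?_⟩
  rw [add_mul, add_mul, map_add]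
  exact (norm_add_le _ _).trans (add_le_add (hC y) (hC' y))

theorem LeftBounded.mul {x x' : B} (h : hφ.LeftBounded x) (h' : hφ.LeftBounded x') :
    hφ.LeftBounded (x * x') := by
  obtain ⟨C, hC⟩ := h
  obtain ⟨C', hC'⟩ := h'
  -- `LeftBounded` does not force `C` to be nonnegative, hence the absolute value.
  refine ⟨|C| * C', fun y => ?_⟩
  rw [mul_assoc, mul_assoc]
  calc _ ≤ C * ‖hφ.toPreGNS (x' * y)‖ := hC _
    _ ≤ |C| * ‖hφ.toPreGNS (x' * y)‖ := by gcongr; exact le_abs_self C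
    _ ≤ |C| * (C' * ‖hφ.toPreGNS y‖) := by gcongr; exact hC' y

variable (hφ)

/-- The image of a `C*`-algebra acts by bounded operators. -/
theorem leftBounded_starAlgHom {A : Type v} [CStarAlgebra A] (ι : A →⋆ₐ[ℂ] B) (a : A) :
    hφ.LeftBounded (ι a) := by
  let _ := CStarAlgebra.spectralOrder A
  let _ := CStarAlgebra.spectralOrderedRing A
  -- Write `‖a‖² - a* a = s* s` in the `C*`-algebra. Then `‖a‖² φ(y* y) - φ((a y)* (a y)) = φ((s y)*
  -- (s y)) ≥ 0`, although `B` itself carries no norm.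
  obtain ⟨s, hs⟩ := CStarAlgebra.nonneg_iff_eq_star_mul_self.1
    (sub_nonneg.2 (CStarAlgebra.star_mul_le_algebraMap_norm_sq (a := a)))
  refine ⟨‖a‖, fun y => ?_⟩
  refine le_of_sq_le_sq ?_ (by positivity)
  rw [mul_pow, hφ.norm_sq_toPreGNS, hφ.norm_sq_toPreGNS]
  have h := (Complex.nonneg_iff.1 (hφ (ι s * y))).1
  have hs' : star (ι s) * ι s = ((‖a‖ ^ 2 : ℝ) : ℂ) • 1 - star (ι a) * ι a := by
    rw [← map_star, ← map_mul, ← hs, map_sub, map_mul, map_star]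
    congr 1
    rw [Algebra.algebraMap_eq_smul_one, ← Complex.coe_smul, map_smul, map_one]
  have key : star (ι s * y) * (ι s * y)
      = ((‖a‖ ^ 2 : ℝ) : ℂ) • (star y * y) - star (ι a * y) * (ι a * y) := by
    rw [star_mul, star_mul, mul_assoc, ← mul_assoc (star (ι s)), hs', sub_mul, mul_sub,
      smul_mul_assoc, one_mul, mul_smul_comm]
    simp only [mul_assoc]
  rw [key, map_sub, map_smul, smul_eq_mul, Complex.sub_re, Complex.re_ofReal_mul] at h
  linarith

/-- The Hilbert space of the GNS representation. -/
abbrev GNS := UniformSpace.Completion hφ.PreGNS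

variable {hφ} (hb : ∀ x, hφ.LeftBounded x)

/-- Left multiplication on `PreGNS`. -/
def leftMul (hb : ∀ x, hφ.LeftBounded x) (x : B) : hφ.PreGNS →L[ℂ] hφ.PreGNS :=
  LinearMap.mkContinuousOfExistsBound
    (hφ.toPreGNS.toLinearMap ∘ₗ LinearMap.mulLeft ℂ x ∘ₗ hφ.toPreGNS.symm.toLinearMap)
    ⟨(hb x).choose, fun y => (hb x).choose_spec (hφ.toPreGNS.symm y)⟩

theorem leftMul_apply (x y : B) :
    leftMul hb x (hφ.toPreGNS y) = hφ.toPreGNS (x * y) := rfl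

/-- The GNS operators. -/
def gnsOp (x : B) : hφ.GNS →L[ℂ] hφ.GNS := (leftMul hb x).completion

theorem gnsOp_coe (x y : B) :
    gnsOp hb x (hφ.toPreGNS y : hφ.GNS) = (hφ.toPreGNS (x * y) : hφ.GNS) := by
  simp [gnsOp, leftMul_apply]

/-- The completion is Hausdorff, so null vectors vanish without a separate quotient, and the image
of `B` is dense. Most identities of `gnsHom` thus reduce to identities in `B`. -/
theorem gns_ext {S T : hφ.GNS →L[ℂ] hφ.GNS}
    (h : ∀ y : B, S (hφ.toPreGNS y : hφ.GNS) = T (hφ.toPreGNS y : hφ.GNS)) : S = T := by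
  ext z
  induction z using UniformSpace.Completion.induction_on with
  | hp => exact isClosed_eq S.continuous T.continuous
  | ih a => exact h (hφ.toPreGNS.symm a)

/-- The GNS representation. -/
def gnsHom : B →⋆ₐ[ℂ] (hφ.GNS →L[ℂ] hφ.GNS) where
  toFun := gnsOp hb
  map_one' := gns_ext fun y => by simp [gnsOp_coe]
  map_mul' x x' := gns_ext fun y => by simp [gnsOp_coe, mul_assoc]
  map_zero' := gns_ext fun y => by
    rw [gnsOp_coe, zero_mul, map_zero, UniformSpace.Completion.coe_zero,
      zero_apply]
  map_add' x x' := gns_ext fun y => by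
    simp [gnsOp_coe, add_mul, UniformSpace.Completion.coe_add]
  commutes' c := gns_ext fun y => by
    simp [gnsOp_coe, Algebra.algebraMap_eq_smul_one, UniformSpace.Completion.coe_smul]
  map_star' x := by
    refine (ContinuousLinearMap.eq_adjoint_iff _ _).2 fun y z => ?_
    induction y, z using UniformSpace.Completion.induction_on₂ with
    | hp => apply isClosed_eq <;> fun_prop
    | ih y z =>
      obtain ⟨y, rfl⟩ := hφ.toPreGNS.surjective y
      obtain ⟨z, rfl⟩ := hφ.toPreGNS.surjective z
      rw [gnsOp_coe, gnsOp_coe, UniformSpace.Completion.inner_coe,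
        UniformSpace.Completion.inner_coe, inner_toPreGNS, inner_toPreGNS, star_mul, star_star,
        mul_assoc]

/-- A positive functional with bounded left multiplications has a GNS representation. -/
def gnsRep : GNSRep.{u, u} φ where
  H := hφ.GNS
  rep := gnsHom hb
  vec := (hφ.toPreGNS 1 : hφ.GNS)
  cyclic := by
    have h : (fun x => gnsHom hb x (hφ.toPreGNS 1 : hφ.GNS))
        = (fun y : hφ.PreGNS => (y : hφ.GNS)) ∘ hφ.toPreGNS := by
      ext x
      exact (gnsOp_coe hb x 1).trans (by rw [mul_one]; rfl)
    rw [h]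
    exact UniformSpace.Completion.denseRange_coe.comp hφ.toPreGNS.surjective.denseRange
      (UniformSpace.Completion.continuous_coe _)
  inner_vec x := by
    change Inner.inner ℂ _ (gnsOp hb x _) = _
    rw [gnsOp_coe, UniformSpace.Completion.inner_coe, inner_toPreGNS, mul_one, star_one, one_mul]

end IsPositiveFunctional

/-! ### Unitary implementation of gradings in GNS representations -/

namespace GNSRep

variable {φ : B →ₗ[ℂ] ℂ} (π : GNSRep.{u, w} φ)

/-- The geometry of the orbit of the cyclic vector depends on `φ` alone; this is what turns
invariance of `φ` into an isometry. -/
theorem inner_rep_vec (x y : B) :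
    Inner.inner ℂ (π.rep x π.vec) (π.rep y π.vec) = φ (star x * y) := by
  rw [← π.inner_vec, map_mul, map_star, mul_apply_eq_comp,
    ContinuousLinearMap.star_eq_adjoint, ContinuousLinearMap.adjoint_inner_right]

/-- The orbit map of the cyclic vector. -/
def orbit : B →ₗ[ℂ] π.H where
  toFun x := π.rep x π.vec
  map_add' x y := by simp
  map_smul' c x := by simp

theorem norm_orbit_sq (x : B) : ‖π.orbit x‖ ^ 2 = (φ (star x * x)).re := by
  rw [← π.inner_rep_vec, ← inner_self_eq_norm_sq (𝕜 := ℂ)]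
  rfl

/-- If a functional is invariant under a grading, the grading is unitarily implemented in each of
its GNS representations. -/
theorem exists_implementing_unitary (θ : Z2Grading B) (hθ : ∀ x, φ (θ.aut x) = φ x) :
    ∃ V : π.H →L[ℂ] π.H, V ∈ unitary (π.H →L[ℂ] π.H) ∧ IsSelfAdjoint V ∧ V π.vec = π.vec ∧
      ∀ x, π.rep (θ.aut x) = V * π.rep x * V := by
  let e : B ≃ₗ[ℂ] B := θ.aut.toAlgEquiv.toLinearEquiv
  have he : ∀ x, e x = θ.aut x := fun _ => rfl
  -- Invariance of `φ` makes `π(x)ξ ↦ π(θ x)ξ` norm-preserving, hence well defined on the dense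
  -- orbit and extendable to a unitary.
  have hnorm : ∀ x, ‖π.orbit (e x)‖ = ‖π.orbit x‖ := fun x => by
    rw [← sq_eq_sq₀ (norm_nonneg _) (norm_nonneg _), norm_orbit_sq, norm_orbit_sq, he, ← map_star,
      ← map_mul, hθ]
  let U := e.extendOfIsometry π.orbit π.orbit π.cyclic π.cyclic hnorm
  let V : π.H →L[ℂ] π.H := U.toContinuousLinearEquiv
  have hV : ∀ x, V (π.rep x π.vec) = π.rep (θ.aut x) π.vec :=
    fun x => e.extendOfIsometry_eq π.orbit π.orbit π.cyclic π.cyclic hnorm x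
  have hext : ∀ S T : π.H →L[ℂ] π.H,
      (∀ x, S (π.rep x π.vec) = T (π.rep x π.vec)) → S = T := fun S T h =>
    DFunLike.coe_injective (π.cyclic.equalizer S.continuous T.continuous (funext h))
  have hVV : V * V = 1 := hext _ _ fun x => by
    rw [mul_apply_eq_comp, hV, hV, θ.invol]; rfl
  have hUV : star V * V = 1 := by
    rw [ContinuousLinearMap.star_eq_adjoint]
    exact (ContinuousLinearMap.norm_map_iff_adjoint_comp_self V).1 fun x => U.norm_map x
  -- An isometry with `V² = 1` is self-adjoint: `V* = V* V V = V`.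
  have hsa : star V = V := by
    calc star V = star V * (V * V) := by rw [hVV, mul_one]
      _ = V := by rw [← mul_assoc, hUV, one_mul]
  have hvec : V π.vec = π.vec := by
    simpa using hV 1
  refine ⟨V, ?_, hsa, hvec, fun x => hext _ _ fun y => ?_⟩
  · rw [Unitary.mem_iff, hsa]; exact ⟨hVV, hVV⟩
  -- On the orbit, `V π(x) V π(y)ξ = V π(x θ(y))ξ = π(θ(x) y)ξ`.
  · rw [mul_apply_eq_comp, mul_apply_eq_comp, hV,
      ← mul_apply_eq_comp (π.rep x), ← map_mul, hV, map_mul, θ.invol, map_mul]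
    rfl

/-- A GNS representation composed with a `*`-automorphism that leaves the functional invariant. -/
def compAut (θ : Z2Grading B) (hθ : ∀ x, φ (θ.aut x) = φ x) : GNSRep.{u, w} φ where
  toHilbertRep := { H := π.H, rep := π.rep.comp (θ.aut : B →⋆ₐ[ℂ] B) }
  vec := π.vec
  cyclic := by
    have h : DenseRange ((fun x => π.rep x π.vec) ∘ θ.aut) := by
      rw [DenseRange, Function.Surjective.range_comp (f := θ.aut) (EquivLike.surjective θ.aut)]
      exact π.cyclic
    exact h
  inner_vec x := (π.inner_vec (θ.aut x)).trans (hθ x)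

end GNSRep

end GNS

/-! ### States of `C*`-algebras -/

section States

variable {A : Type u} [CStarAlgebra A]

/-- The states of a `C*`-algebra separate the positive elements from `0`. -/
theorem exists_isState_apply_ne_zero {b : A} (hb : b ≠ 0) :
    ∃ ω : A →ₗ[ℂ] ℂ, IsState ω ∧ ω (star b * b) ≠ 0 := by
  let _ := CStarAlgebra.spectralOrder A
  let _ := CStarAlgebra.spectralOrderedRing A
  let C : ProperCone ℝ A := ProperCone.positive ℝ A
  have hC : ∀ a, a ∈ C ↔ 0 ≤ a := fun _ => Iff.rfl
  have hmem : -(star b * b) ∉ C := fun h => by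
    have h0 : star b * b = 0 :=
      le_antisymm (neg_nonneg.1 ((hC _).1 h)) (star_mul_self_nonneg b)
    exact hb (CStarRing.star_mul_self_eq_zero_iff b |>.1 h0)
  -- Hahn-Banach: `f` is nonnegative on the positive cone and negative at `-(b* b)`.
  obtain ⟨f, hf, hfb⟩ := C.hyperplane_separation_point hmem
  -- Adding `f ∘ star` makes the functional vanish on `i a* a`, so its complex-linear extension is
  -- real on the elements `a* a`.
  let g : Module.Dual ℝ A :=
    { toFun := fun a => f a + f (star a)
      map_add' := fun a b => by simp only [star_add, map_add]; ring
      map_smul' := fun c a => by simp [mul_add] }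
  let G : A →ₗ[ℂ] ℂ := Module.Dual.extendRCLike (𝕜 := ℂ) g
  have hG : ∀ a, G (star a * a) = ((2 * f (star a * a) : ℝ) : ℂ) := fun a => by
    have h1 : g (star a * a) = 2 * f (star a * a) := by
      change f _ + f _ = _
      rw [star_mul, star_star]; ring
    have h2 : g (Complex.I • (star a * a)) = 0 := by
      change f _ + f _ = _
      rw [star_smul, star_mul, star_star, RCLike.star_def, Complex.conj_I, neg_smul, map_neg,
        add_neg_cancel]
    refine (Module.Dual.extendRCLike_apply (𝕜 := ℂ) g _).trans ?_
    rw [h1]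
    change _ - Complex.I * ((g (Complex.I • (star a * a)) : ℝ) : ℂ) = _
    rw [h2]
    simp
  have hpos : IsPositiveFunctional G := fun a => by
    rw [hG]
    exact Complex.zero_le_real.2 (mul_nonneg zero_le_two (hf _ (star_mul_self_nonneg a)))
  have hGb : G (star b * b) ≠ 0 := by
    rw [hG, map_neg] at *
    exact Complex.ofReal_ne_zero.2 (by linarith)
  -- Normalization is possible: if `G 1 = 0`, then `1` is a null vector, and boundedness of left
  -- multiplication by `b` makes `b · 1` null, against `G (b* b) ≠ 0`.
  have hG1 : G 1 ≠ 0 := fun h1 => by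
    have hn : ‖hpos.toPreGNS 1‖ = 0 := by
      rw [← sq_eq_zero_iff, hpos.norm_sq_toPreGNS, star_one, one_mul, h1, Complex.zero_re]
    obtain ⟨K, hK⟩ := hpos.leftBounded_starAlgHom (StarAlgHom.id ℂ A) b
    have h := hK 1
    rw [hn, mul_zero, mul_one, StarAlgHom.coe_id, id_eq] at h
    have h' : ‖hpos.toPreGNS b‖ ^ 2 = 0 := by
      rw [le_antisymm h (norm_nonneg _)]; simp
    rw [hpos.norm_sq_toPreGNS, hG, Complex.ofReal_re] at h'
    rw [hG, h'] at hGb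
    exact hGb Complex.ofReal_zero
  have hG1' : 0 ≤ G 1 := by simpa using hpos 1
  refine ⟨(G 1)⁻¹ • G, ⟨by simp [hG1], fun a => ?_⟩, ?_⟩
  · exact mul_nonneg (inv_nonneg.2 hG1') (hpos a)
  · exact mul_ne_zero (inv_ne_zero hG1) hGb

/-- The even states of a graded `C*`-algebra separate the positive elements from `0`. -/
theorem exists_isEvenState_apply_ne_zero (θ : Z2Grading A) {b : A} (hb : b ≠ 0) :
    ∃ ω : A →ₗ[ℂ] ℂ, IsEvenState θ ω ∧ ω (star b * b) ≠ 0 := by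
  obtain ⟨ω, hω, hωb⟩ := exists_isState_apply_ne_zero hb
  have hθ : ∀ a, 0 ≤ ω (θ.aut (star a * a)) := fun a => by
    rw [map_mul, map_star]; exact hω.nonneg _
  have h2 : (0 : ℂ) ≤ 2⁻¹ := inv_nonneg.2 zero_le_two
  -- Average over the grading. Both summands are nonnegative at `b* b`, so they cannot cancel.
  refine ⟨(2⁻¹ : ℂ) • (ω + ω ∘ₗ θ.aut.toAlgEquiv.toLinearMap), ⟨⟨?_, fun a => ?_⟩, fun a => ?_⟩, ?_⟩
  · change (2⁻¹ : ℂ) * (ω 1 + ω (θ.aut 1)) = 1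
    rw [map_one θ.aut, hω.map_one]; norm_num
  · exact mul_nonneg h2 (add_nonneg (hω.nonneg a) (hθ a))
  · change (2⁻¹ : ℂ) * (ω (θ.aut a) + ω (θ.aut (θ.aut a))) = (2⁻¹ : ℂ) * (ω a + ω (θ.aut a))
    rw [θ.invol, add_comm]
  · refine mul_ne_zero (by norm_num) fun h => hωb ?_
    exact ((add_eq_zero_iff_of_nonneg (hω.nonneg b) (hθ b)).1 h).1

end States

/-! ### Product functionals -/

section ProdFunctional

theorem IsEvenState.apply_odd {A : Type u} [Ring A] [StarRing A] [Algebra ℂ A] {θ : Z2Grading A}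
    {ω : A →ₗ[ℂ] ℂ} (h : IsEvenState θ ω) {a : A} (ha : a ∈ θ.part 1) : ω a = 0 := by
  have h1 := h.even a
  rw [θ.mem_part_one.1 ha, map_neg] at h1
  exact self_eq_neg.1 h1.symm

variable {A₁ : Type u} {A₂ : Type v} [Ring A₁] [StarRing A₁] [Algebra ℂ A₁]
  [Ring A₂] [StarRing A₂] [Algebra ℂ A₂]
  {θ₁ : Z2Grading A₁} {θ₂ : Z2Grading A₂}

theorem prodFunctional_ftmul (ω₁ : A₁ →ₗ[ℂ] ℂ) (ω₂ : A₂ →ₗ[ℂ] ℂ) (a : A₁) (b : A₂) :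
    prodFunctional θ₁ θ₂ ω₁ ω₂ (ftmul θ₁ θ₂ a b) = ω₁ a * ω₂ b := rfl

theorem ftmul_add (a : A₁) (b b' : A₂) :
    ftmul θ₁ θ₂ a (b + b') = ftmul θ₁ θ₂ a b + ftmul θ₁ θ₂ a b' := by
  simp [ftmul, TensorProduct.tmul_add]

theorem add_ftmul (a a' : A₁) (b : A₂) :
    ftmul θ₁ θ₂ (a + a') b = ftmul θ₁ θ₂ a b + ftmul θ₁ θ₂ a' b := by
  simp [ftmul, TensorProduct.add_tmul]

theorem exists_eq_sum_ftmul (x : Fermi θ₁ θ₂) :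
    ∃ S : Finset (A₁ × A₂), x = ∑ p ∈ S, ftmul θ₁ θ₂ p.1 p.2 := by
  obtain ⟨S, hS⟩ := TensorProduct.exists_finset
    ((GradedTensorProduct.of ℂ θ₁.part θ₂.part).symm x)
  refine ⟨S, ?_⟩
  rw [← map_sum, ← hS, LinearEquiv.apply_symm_apply]

variable {ω₁ : A₁ →ₗ[ℂ] ℂ} {ω₂ : A₂ →ₗ[ℂ] ℂ}

variable [StarModule ℂ A₁] [StarModule ℂ A₂]

theorem prodFunctional_prodGrading (h₁ : IsEvenState θ₁ ω₁) (h₂ : IsEvenState θ₂ ω₂)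
    (x : Fermi θ₁ θ₂) :
    prodFunctional θ₁ θ₂ ω₁ ω₂ ((prodGrading θ₁ θ₂).aut x) = prodFunctional θ₁ θ₂ ω₁ ω₂ x := by
  induction x using fermi_induction with
  | zero => rw [map_zero]
  | add x y hx hy => rw [map_add, map_add, map_add, hx, hy]
  | tmul i j a b ha hb =>
    rw [prodGrading_ftmul, prodFunctional_ftmul, prodFunctional_ftmul, h₁.even, h₂.even]

/-- The involution contributes `sgn i j` and the product `sgn j k`. Their product is `-1` only if
`j` is odd and `i ≠ k`; then `star a * c` is odd and the even functional `ω₁` kills it. -/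
theorem prodFunctional_star_mul_homogeneous (h₁ : IsEvenState θ₁ ω₁)
    {i j k l : ZMod 2} {a : A₁} {b : A₂} {c : A₁} {d : A₂}
    (ha : a ∈ θ₁.part i) (hb : b ∈ θ₂.part j) (hc : c ∈ θ₁.part k) (hd : d ∈ θ₂.part l) :
    prodFunctional θ₁ θ₂ ω₁ ω₂ (star (ftmul θ₁ θ₂ a b) * ftmul θ₁ θ₂ c d)
      = ω₁ (star a * c) * ω₂ (star b * d) := by
  rw [star_ftmul ha hb, smul_mul_assoc, ftmul_mul_ftmul (θ₁.star_mem ha) (θ₂.star_mem hb) hc hd,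
    map_smul, map_smul, prodFunctional_ftmul]
  have h₁' : i + k = 1 → ω₁ (star a * c) = 0 := fun h =>
    h₁.apply_odd (h ▸ SetLike.mul_mem_graded (θ₁.star_mem ha) hc)
  rcases zmod_two_cases i with rfl | rfl <;> rcases zmod_two_cases j with rfl | rfl <;>
    rcases zmod_two_cases k with rfl | rfl <;> simp [sgn, h₁']

/-- If `ω₁` is even, the sesquilinear form of `ω₁ × ω₂` is the tensor product of the sesquilinear
forms of the factors. -/
theorem prodFunctional_star_mul (h₁ : IsEvenState θ₁ ω₁)
    (a : A₁) (b : A₂) (c : A₁) (d : A₂) :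
    prodFunctional θ₁ θ₂ ω₁ ω₂ (star (ftmul θ₁ θ₂ a b) * ftmul θ₁ θ₂ c d)
      = ω₁ (star a * c) * ω₂ (star b * d) := by
  have H := fun i j k l => prodFunctional_star_mul_homogeneous (ω₂ := ω₂) h₁ (θ₁.proj_mem i a)
    (θ₂.proj_mem j b) (θ₁.proj_mem k c) (θ₂.proj_mem l d)
  rw [← θ₁.proj_add_proj a, ← θ₂.proj_add_proj b, ← θ₁.proj_add_proj c, ← θ₂.proj_add_proj d]
  simp only [add_ftmul, ftmul_add, star_add, add_mul, mul_add, map_add, H]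
  ring

/-- The quadratic form of the matrix at `z` is `ω (star s * s)` with `s = ∑ z i • a i`. -/
theorem IsState.posSemidef_gram {A : Type u} [Ring A] [StarRing A] [Algebra ℂ A] [StarModule ℂ A]
    {ω : A →ₗ[ℂ] ℂ} (h : IsState ω) {ι : Type w} [Fintype ι] (a : ι → A) :
    (Matrix.of fun i j => ω (star (a i) * a j)).PosSemidef := by
  have hpos : IsPositiveFunctional ω := h.nonneg
  refine Matrix.posSemidef_iff_dotProduct_mulVec.2 ⟨?_, fun z => ?_⟩
  · ext i j
    exact hpos.conj_apply _ _
  · convert h.nonneg (∑ i, z i • a i) using 1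
    rw [star_sum, Finset.sum_mul_sum, map_sum]
    simp only [dotProduct, Matrix.mulVec, Matrix.of_apply, Pi.star_apply, star_smul,
      map_sum, smul_mul_smul_comm, map_smul, smul_eq_mul, Finset.mul_sum]
    refine Finset.sum_congr rfl fun i _ => Finset.sum_congr rfl fun j _ => by ring

/-- The product of an even state and a state is positive. -/
theorem isPositiveFunctional_prodFunctional (h₁ : IsEvenState θ₁ ω₁) (h₂ : IsState ω₂) :
    IsPositiveFunctional (prodFunctional θ₁ θ₂ ω₁ ω₂) := fun x => by
  obtain ⟨S, rfl⟩ := exists_eq_sum_ftmul x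
  -- Schur product theorem. The entrywise product of the two Gram matrices, evaluated at the
  -- all-ones vector, is the value of the product functional at `x* x`.
  have hM := ((h₁.toIsState.posSemidef_gram fun p : S => p.1.1).hadamard
    (h₂.posSemidef_gram fun p : S => p.1.2))
  convert (Matrix.posSemidef_iff_dotProduct_mulVec.1 hM).2 1 using 1
  rw [star_sum, Finset.sum_mul_sum, map_sum, ← Finset.sum_coe_sort]
  simp only [dotProduct, Matrix.mulVec, Matrix.hadamard_apply, Matrix.of_apply, Pi.star_apply,
    Pi.one_apply, star_one, one_mul, mul_one]
  refine Finset.sum_congr rfl fun p _ => ?_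
  rw [map_sum, ← Finset.sum_coe_sort]
  exact Finset.sum_congr rfl fun q _ => prodFunctional_star_mul h₁ _ _ _ _

end ProdFunctional

/-! ### The factors of the Fermi product -/

section Factors

variable {A₁ : Type u} {A₂ : Type v} [Ring A₁] [StarRing A₁] [Algebra ℂ A₁]
  [Ring A₂] [StarRing A₂] [Algebra ℂ A₂] [StarModule ℂ A₁] [StarModule ℂ A₂]
  (θ₁ : Z2Grading A₁) (θ₂ : Z2Grading A₂)

/-- The embedding `a ↦ a ⊗ 1` of the first factor. -/
def inclLeft : A₁ →⋆ₐ[ℂ] Fermi θ₁ θ₂ where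
  toAlgHom := GradedTensorProduct.includeLeft θ₁.part θ₂.part
  map_star' a := by
    change ftmul θ₁ θ₂ (star a) 1 = star (ftmul θ₁ θ₂ a 1)
    have h1 : (1 : A₂) ∈ θ₂.part 0 := SetLike.GradedOne.one_mem
    rw [← θ₁.proj_add_proj a, star_add, add_ftmul, add_ftmul, star_add,
      star_ftmul (θ₁.proj_mem 0 a) h1, star_ftmul (θ₁.proj_mem 1 a) h1]
    simp [sgn]

/-- The embedding `b ↦ 1 ⊗ b` of the second factor. -/
def inclRight : A₂ →⋆ₐ[ℂ] Fermi θ₁ θ₂ where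
  toAlgHom := GradedTensorProduct.includeRight θ₁.part θ₂.part
  map_star' b := by
    change ftmul θ₁ θ₂ 1 (star b) = star (ftmul θ₁ θ₂ 1 b)
    have h1 : (1 : A₁) ∈ θ₁.part 0 := SetLike.GradedOne.one_mem
    rw [← θ₂.proj_add_proj b, star_add, ftmul_add, ftmul_add, star_add,
      star_ftmul h1 (θ₂.proj_mem 0 b), star_ftmul h1 (θ₂.proj_mem 1 b)]
    simp [sgn]

theorem inclLeft_mul_inclRight (a : A₁) (b : A₂) :
    inclLeft θ₁ θ₂ a * inclRight θ₁ θ₂ b = ftmul θ₁ θ₂ a b := by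
  exact GradedTensorProduct.tmul_one_mul_one_tmul θ₁.part θ₂.part a b

end Factors

/-! ### Boundedness and separation of points for `C*`-algebra factors -/

section CStar

variable {A₁ : Type u} {A₂ : Type v} [CStarAlgebra A₁] [CStarAlgebra A₂]
  {θ₁ : Z2Grading A₁} {θ₂ : Z2Grading A₂}

/-- An elementary tensor is a product of one element from each embedded `C*`-algebra, and each of
these is left bounded for any positive functional. -/
theorem IsPositiveFunctional.leftBounded_fermi {φ : Fermi θ₁ θ₂ →ₗ[ℂ] ℂ}
    (hφ : IsPositiveFunctional φ) (x : Fermi θ₁ θ₂) : hφ.LeftBounded x := by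
  induction x using fermi_induction with
  | zero => exact .zero
  | add x y hx hy => exact hx.add hy
  | tmul i j a b _ _ =>
    rw [← inclLeft_mul_inclRight]
    exact (hφ.leftBounded_starAlgHom (inclLeft θ₁ θ₂) a).mul
      (hφ.leftBounded_starAlgHom (inclRight θ₁ θ₂) b)

/-- The GNS representation of a product of even states. -/
def prodGNSRep {ω₁ : A₁ →ₗ[ℂ] ℂ} {ω₂ : A₂ →ₗ[ℂ] ℂ} (h₁ : IsEvenState θ₁ ω₁)
    (h₂ : IsEvenState θ₂ ω₂) :
    GNSRep.{max u v, max u v} (prodFunctional θ₁ θ₂ ω₁ ω₂) :=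
  IsPositiveFunctional.gnsRep
    (isPositiveFunctional_prodFunctional h₁ h₂.toIsState).leftBounded_fermi

/-- The representations of the Fermi product are uniformly bounded at each point. -/
theorem exists_norm_rep_le (x : Fermi θ₁ θ₂) :
    ∃ C, ∀ π : HilbertRep.{max u v, w} (Fermi θ₁ θ₂), ‖π.rep x‖ ≤ C := by
  induction x using fermi_induction with
  | zero => exact ⟨0, fun π => by simp⟩
  | add x y hx hy =>
    obtain ⟨C, hC⟩ := hx
    obtain ⟨D, hD⟩ := hy
    refine ⟨C + D, fun π => ?_⟩
    rw [map_add]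
    exact (norm_add_le _ _).trans (add_le_add (hC π) (hD π))
  | tmul i j a b _ _ =>
    -- The bound does not depend on `π`, because `*`-homomorphisms from a `C*`-algebra are
    -- contractive.
    refine ⟨‖a‖ * ‖b‖, fun π => ?_⟩
    rw [← inclLeft_mul_inclRight, map_mul]
    exact (norm_mul_le _ _).trans (mul_le_mul
      (NonUnitalStarAlgHom.norm_apply_le (π.rep.comp (inclLeft θ₁ θ₂)) a)
      (NonUnitalStarAlgHom.norm_apply_le (π.rep.comp (inclRight θ₁ θ₂)) b)
      (norm_nonneg _) (norm_nonneg _))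

/-- The products of even states separate the points of the Fermi product. -/
theorem eq_zero_of_prodFunctional_star_mul_eq_zero {x : Fermi θ₁ θ₂}
    (hx : ∀ ω₁ ω₂, IsEvenState θ₁ ω₁ → IsEvenState θ₂ ω₂ →
      ∀ y, prodFunctional θ₁ θ₂ ω₁ ω₂ (star y * x) = 0) : x = 0 := by
  -- Write `x` as a finite sum `∑ f k ⊗ e k` with `e` a basis of `A₂`; it remains to show that the
  -- coefficients `f k` vanish.
  obtain ⟨f, hf⟩ := TensorProduct.eq_repr_basis_right (Module.Free.chooseBasis ℂ A₂)
    ((GradedTensorProduct.of ℂ θ₁.part θ₂.part).symm x)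
  set e := Module.Free.chooseBasis ℂ A₂
  have hx' : x = ∑ k ∈ f.support, ftmul θ₁ θ₂ (f k) (e k) := by
    rw [← map_sum]
    exact ((GradedTensorProduct.of ℂ θ₁.part θ₂.part).symm_apply_eq).1 hf.symm
  have hsum : ∀ ω₁, IsEvenState θ₁ ω₁ → ∀ c, ∑ k ∈ f.support, ω₁ (star c * f k) • e k = 0 := by
    intro ω₁ h₁ c
    by_contra hne
    obtain ⟨ω₂, h₂, hω₂⟩ := exists_isEvenState_apply_ne_zero θ₂ hne
    refine hω₂ ?_
    -- With `z = ∑ ω₁(c* f k) e k`, testing `x` against `y = c ⊗ z` yields exactly `ω₂(z* z)`.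
    have h := hx ω₁ ω₂ h₁ h₂ (ftmul θ₁ θ₂ c (∑ k ∈ f.support, ω₁ (star c * f k) • e k))
    rw [hx', Finset.mul_sum, map_sum] at h
    simp only [prodFunctional_star_mul h₁] at h
    rw [← h, Finset.mul_sum, map_sum]
    simp only [mul_smul_comm, map_smul, smul_eq_mul]
  have hf0 : ∀ k ∈ f.support, f k = 0 := by
    intro k hk
    by_contra hne
    obtain ⟨ω₁, h₁, hω₁⟩ := exists_isEvenState_apply_ne_zero θ₁ hne
    -- Take `c = f k`: linear independence of `e` forces `ω₁((f k)* f k) = 0`.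
    exact hω₁ (linearIndependent_iff'.1 e.linearIndependent f.support _ (hsum ω₁ h₁ (f k)) k hk)
  rw [hx']
  exact Finset.sum_eq_zero fun k hk => by simp [ftmul, hf0 k hk]

/-- The GNS representations of the products of even states separate the points of the Fermi
product. -/
theorem eq_zero_of_gnsRep_eq_zero {x : Fermi θ₁ θ₂}
    (hx : ∀ ω₁ ω₂, IsEvenState θ₁ ω₁ → IsEvenState θ₂ ω₂ →
      ∀ π : GNSRep.{max u v, max u v} (prodFunctional θ₁ θ₂ ω₁ ω₂), π.rep x = 0) : x = 0 := by
  refine eq_zero_of_prodFunctional_star_mul_eq_zero fun ω₁ ω₂ h₁ h₂ y => ?_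
  have h := hx ω₁ ω₂ h₁ h₂ (prodGNSRep h₁ h₂)
  rw [← GNSRep.inner_rep_vec (prodGNSRep h₁ h₂), h]
  simp

end CStar

/-! ### `C*`-norms defined by representations -/

section RepNorm

variable {B : Type u} [Ring B] [StarRing B] [Algebra ℂ B]

/-- The supremum of `‖π x‖` over the representations `π` in a class `P`. -/
def repNorm (P : HilbertRep.{u, w} B → Prop) (x : B) : ℝ :=
  sSup {r | ∃ π, P π ∧ r = ‖π.rep x‖}

variable {P : HilbertRep.{u, w} B → Prop}

theorem repNorm_nonneg (x : B) : 0 ≤ repNorm P x :=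
  Real.sSup_nonneg (by rintro _ ⟨π, -, rfl⟩; exact norm_nonneg _)

/-- Assuming `0 ≤ C` covers an empty class, whose supremum is `0` by convention. -/
theorem repNorm_le {x : B} {C : ℝ} (hC : 0 ≤ C) (h : ∀ π, P π → ‖π.rep x‖ ≤ C) :
    repNorm P x ≤ C :=
  Real.sSup_le (by rintro _ ⟨π, hπ, rfl⟩; exact h π hπ) hC

/-- Pointwise boundedness is essential: the real supremum of an unbounded set is `0` by convention.
-/
theorem norm_rep_le_repNorm (hbdd : ∀ x, ∃ C, ∀ π, P π → ‖π.rep x‖ ≤ C) {π : HilbertRep.{u, w} B}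
    (hπ : P π) (x : B) : ‖π.rep x‖ ≤ repNorm P x := by
  obtain ⟨C, hC⟩ := hbdd x
  exact le_csSup ⟨C, by rintro _ ⟨σ, hσ, rfl⟩; exact hC σ hσ⟩ ⟨π, hπ, rfl⟩

/-- A pointwise bounded class of representations that separates points defines a `C*`-norm. -/
def repCStarNorm (P : HilbertRep.{u, w} B → Prop) (hbdd : ∀ x, ∃ C, ∀ π, P π → ‖π.rep x‖ ≤ C)
    (hsep : ∀ x, (∀ π, P π → π.rep x = 0) → x = 0) : CStarNorm B :=
  have hle {π : HilbertRep.{u, w} B} (hπ : P π) (x : B) : ‖π.rep x‖ ≤ repNorm P x :=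
    norm_rep_le_repNorm hbdd hπ x
  have hsmul (c : ℂ) (x : B) : repNorm P (c • x) ≤ ‖c‖ * repNorm P x :=
    repNorm_le (mul_nonneg (norm_nonneg _) (repNorm_nonneg _)) fun π hπ => by
      rw [map_smul, norm_smul]
      exact mul_le_mul_of_nonneg_left (hle hπ x) (norm_nonneg _)
  { toFun := repNorm P
    map_zero' := le_antisymm (repNorm_le le_rfl fun π _ => by rw [map_zero, norm_zero])
      (repNorm_nonneg _)
    add_le' := fun x y => repNorm_le (add_nonneg (repNorm_nonneg _) (repNorm_nonneg _))
      fun π hπ => by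
        rw [map_add]
        exact (norm_add_le _ _).trans (add_le_add (hle hπ x) (hle hπ y))
    neg' := fun x => by simp only [repNorm, map_neg, norm_neg]
    mul_le' := fun x y => repNorm_le (mul_nonneg (repNorm_nonneg _) (repNorm_nonneg _))
      fun π hπ => by
        rw [map_mul]
        exact (norm_mul_le _ _).trans
          (mul_le_mul (hle hπ x) (hle hπ y) (norm_nonneg _) (repNorm_nonneg _))
    eq_zero_of_map_eq_zero' := fun x hx => hsep x fun π hπ =>
      norm_le_zero_iff.1 ((hle hπ x).trans hx.le)
    smul' := fun c x => by
      refine le_antisymm (hsmul c x) ?_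
      rcases eq_or_ne c 0 with rfl | hc
      · rw [norm_zero, zero_mul]
        exact repNorm_nonneg _
      -- The reverse inequality is the first one applied to `c⁻¹` and `c • x`.
      · have h := hsmul c⁻¹ (c • x)
        rw [inv_smul_smul₀ hc, norm_inv] at h
        exact (le_inv_mul_iff₀ (norm_pos_iff.2 hc)).1 h
    star_mul_self' := fun x => by
      have hstar (π : HilbertRep.{u, w} B) : ‖π.rep (star x * x)‖ = ‖π.rep x‖ * ‖π.rep x‖ := by
        rw [map_mul, map_star, CStarRing.norm_star_mul_self]
      refine le_antisymm ?_ ?_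
      · refine repNorm_le (mul_nonneg (repNorm_nonneg _) (repNorm_nonneg _)) fun π hπ => ?_
        rw [hstar]
        exact mul_self_le_mul_self (norm_nonneg _) (hle hπ x)
      -- The `C*`-identity of each `π` bounds `‖π x‖` by the square root of the supremum at `x* x`.
      · have h : repNorm P x ≤ √(repNorm P (star x * x)) :=
          repNorm_le (Real.sqrt_nonneg _) fun π hπ => Real.le_sqrt_of_sq_le <| by
            rw [sq, ← hstar]
            exact hle hπ _
        exact (mul_self_le_mul_self (repNorm_nonneg _) h).trans_eq
          (Real.mul_self_sqrt (repNorm_nonneg _)) }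

end RepNorm

/-! ### Extension of automorphisms to the completion -/

namespace CStarNorm

variable {A : Type u} [Ring A] [StarRing A] [Algebra ℂ A] (N : CStarNorm A) (θ : Z2Grading A)

/-- The grading as a map of the normed algebra defined by `N`. -/
def gradingMap (a : N.Carrier) : N.Carrier := θ.aut a

variable {N θ}

theorem uniformContinuous_gradingMap (h : ∀ a, N.toFun (θ.aut a) = N.toFun a) :
    UniformContinuous (N.gradingMap θ) := by
  refine Isometry.uniformContinuous (Isometry.of_dist_eq fun a b => ?_)
  rw [dist_eq_norm, dist_eq_norm]
  exact (congrArg N.toFun (map_sub θ.aut a b).symm).trans (h (a - b))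

/-- An isometric grading extends to the completion. -/
theorem exists_extension_grading (h : ∀ a, N.toFun (θ.aut a) = N.toFun a) :
    ∃ Θ : N.Completion ≃⋆ₐ[ℂ] N.Completion, (∀ z, Θ (Θ z) = z) ∧
      ∀ x, Θ (N.toCompletion x) = N.toCompletion (θ.aut x) := by
  let T : N.Completion → N.Completion := UniformSpace.Completion.map (N.gradingMap θ)
  have hT : Continuous T := UniformSpace.Completion.continuous_map
  have hcoe : ∀ a : N.Carrier, T (a : N.Completion) = ((N.gradingMap θ a : N.Carrier) :) :=
    UniformSpace.Completion.map_coe (uniformContinuous_gradingMap h)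
  have hinv : ∀ z, T (T z) = z := fun z => by
    induction z using UniformSpace.Completion.induction_on with
    | hp => exact isClosed_eq (hT.comp hT) continuous_id
    | ih a =>
      rw [hcoe, hcoe]
      exact congrArg N.toCompletion (θ.invol a)
  refine ⟨{ toFun := T, invFun := T, left_inv := hinv, right_inv := hinv, map_mul' := ?_,
            map_add' := ?_, map_star' := ?_, map_smul' := ?_ }, hinv, hcoe⟩
  · intro x y
    induction x, y using UniformSpace.Completion.induction_on₂ with
    | hp => exact isClosed_eq (by fun_prop) (by fun_prop)
    | ih a b =>
      rw [← UniformSpace.Completion.coe_mul, hcoe, hcoe, hcoe, ← UniformSpace.Completion.coe_mul]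
      exact congrArg N.toCompletion (map_mul θ.aut a b)
  · intro x y
    induction x, y using UniformSpace.Completion.induction_on₂ with
    | hp => exact isClosed_eq (by fun_prop) (by fun_prop)
    | ih a b =>
      rw [← UniformSpace.Completion.coe_add, hcoe, hcoe, hcoe, ← UniformSpace.Completion.coe_add]
      exact congrArg N.toCompletion (map_add θ.aut a b)
  · intro x
    induction x using UniformSpace.Completion.induction_on with
    | hp =>
      exact isClosed_eq (hT.comp N.continuous_star_completion)
        (N.continuous_star_completion.comp hT)
    | ih a =>
      rw [star_coe, hcoe, hcoe, star_coe]
      exact congrArg N.toCompletion (map_star θ.aut a)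
  · intro c x
    induction x using UniformSpace.Completion.induction_on with
    | hp => exact isClosed_eq (hT.comp (continuous_const_smul c)) (hT.const_smul c)
    | ih a =>
      rw [← UniformSpace.Completion.coe_smul, hcoe, hcoe, ← UniformSpace.Completion.coe_smul]
      exact congrArg N.toCompletion (map_smul θ.aut c a)

end CStarNorm

/-! ### Compatibility of the maximal and the spatial norm -/

section Compatible

variable {A₁ : Type u} {A₂ : Type v} [CStarAlgebra A₁] [CStarAlgebra A₂]
  (θ₁ : Z2Grading A₁) (θ₂ : Z2Grading A₂)

variable {θ₁ θ₂} in
/-- The norm defined by a class of representations is compatible if the class separates points and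
is invariant under composition with the grading. -/
theorem isCompatible_repNorm {P : HilbertRep.{max u v, w} (Fermi θ₁ θ₂) → Prop}
    (hsep : ∀ x, (∀ π, P π → π.rep x = 0) → x = 0)
    (hinv : ∀ π, P π → P ⟨π.H, π.rep.comp ((prodGrading θ₁ θ₂).aut : _ →⋆ₐ[ℂ] _)⟩) :
    IsCompatible θ₁ θ₂ (repNorm P) := by
  have hbdd : ∀ x, ∃ C, ∀ π, P π → ‖π.rep x‖ ≤ C := fun x =>
    (exists_norm_rep_le x).imp fun C hC π _ => hC π
  have hle : ∀ x, repNorm P ((prodGrading θ₁ θ₂).aut x) ≤ repNorm P x := fun x =>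
    repNorm_le (repNorm_nonneg _) fun π hπ => norm_rep_le_repNorm hbdd (hinv π hπ) x
  refine ⟨repCStarNorm P hbdd hsep, fun x => rfl, CStarNorm.exists_extension_grading fun x =>
    le_antisymm (hle x) ?_⟩
  -- The inequality at `θ x`, together with `θ² = 1`, is the reverse inequality.
  have h := hle ((prodGrading θ₁ θ₂).aut x)
  rwa [(prodGrading θ₁ θ₂).invol] at h

/-- The class of representations that defines the spatial norm. -/
def IsProdGNSRep (π : HilbertRep.{max u v, max u v} (Fermi θ₁ θ₂)) : Prop :=
  ∃ (ω₁ : A₁ →ₗ[ℂ] ℂ) (ω₂ : A₂ →ₗ[ℂ] ℂ), IsEvenState θ₁ ω₁ ∧ IsEvenState θ₂ ω₂ ∧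
    ∃ σ : GNSRep.{max u v, max u v} (prodFunctional θ₁ θ₂ ω₁ ω₂), σ.toHilbertRep = π

theorem maxNorm_eq_repNorm : maxNorm θ₁ θ₂ =
    repNorm fun _ : HilbertRep.{max u v, max u v} (Fermi θ₁ θ₂) => True := by
  ext x
  simp only [maxNorm, repNorm, true_and]

theorem minNorm_eq_repNorm : minNorm θ₁ θ₂ = repNorm (IsProdGNSRep θ₁ θ₂) := by
  ext x
  refine congrArg sSup (Set.ext fun r => ⟨?_, ?_⟩)
  · rintro ⟨ω₁, ω₂, h₁, h₂, π, rfl⟩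
    exact ⟨π.toHilbertRep, ⟨ω₁, ω₂, h₁, h₂, π, rfl⟩, rfl⟩
  · rintro ⟨_, ⟨ω₁, ω₂, h₁, h₂, π, rfl⟩, rfl⟩
    exact ⟨ω₁, ω₂, h₁, h₂, π, rfl⟩

/-- The maximal norm is compatible. -/
theorem isCompatible_maxNorm : IsCompatible θ₁ θ₂ (maxNorm θ₁ θ₂) := by
  rw [maxNorm_eq_repNorm]
  exact isCompatible_repNorm
    -- The GNS representations of products of even states already separate points, so all
    -- representations do.
    (fun x hx => eq_zero_of_gnsRep_eq_zero fun ω₁ ω₂ _ _ π => hx π.toHilbertRep trivial)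
    fun _ _ => trivial

/-- The spatial norm is compatible. -/
theorem isCompatible_minNorm : IsCompatible θ₁ θ₂ (minNorm θ₁ θ₂) := by
  rw [minNorm_eq_repNorm]
  refine isCompatible_repNorm (fun x hx => eq_zero_of_gnsRep_eq_zero fun ω₁ ω₂ h₁ h₂ π =>
    hx π.toHilbertRep ⟨ω₁, ω₂, h₁, h₂, π, rfl⟩) ?_
  rintro _ ⟨ω₁, ω₂, h₁, h₂, π, rfl⟩
  -- Composing with the grading gives a GNS representation of the same functional, with the same
  -- cyclic vector.
  exact ⟨ω₁, ω₂, h₁, h₂, π.compAut (prodGrading θ₁ θ₂) (prodFunctional_prodGrading h₁ h₂), rfl⟩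

end Compatible

end FermiTensor

end

theorem mainTheorem10 {A₁ : Type u} {A₂ : Type v} [CStarAlgebra A₁] [CStarAlgebra A₂]
    (θ₁ : FermiTensor.Z2Grading A₁) (θ₂ : FermiTensor.Z2Grading A₂) :
    FermiTensor.IsCompatible θ₁ θ₂ (FermiTensor.maxNorm θ₁ θ₂) ∧
    FermiTensor.IsCompatible θ₁ θ₂ (FermiTensor.minNorm θ₁ θ₂) ∧
    ∀ (ω₁ : A₁ →ₗ[ℂ] ℂ) (ω₂ : A₂ →ₗ[ℂ] ℂ),
      FermiTensor.IsEvenState θ₁ ω₁ → FermiTensor.IsEvenState θ₂ ω₂ →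
      Nonempty (FermiTensor.GNSRep.{max u v, max u v}
        (FermiTensor.prodFunctional θ₁ θ₂ ω₁ ω₂)) ∧
      ∀ π : FermiTensor.GNSRep.{max u v, w} (FermiTensor.prodFunctional θ₁ θ₂ ω₁ ω₂),
        ∃ V : π.H →L[ℂ] π.H, V ∈ unitary (π.H →L[ℂ] π.H) ∧ IsSelfAdjoint V ∧ V π.vec = π.vec ∧
          ∀ x, π.rep ((FermiTensor.prodGrading θ₁ θ₂).aut x) = V * π.rep x * V :=
  ⟨FermiTensor.isCompatible_maxNorm θ₁ θ₂, FermiTensor.isCompatible_minNorm θ₁ θ₂,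
    fun _ _ h₁ h₂ => ⟨⟨FermiTensor.prodGNSRep h₁ h₂⟩, fun π =>
      π.exists_implementing_unitary (FermiTensor.prodGrading θ₁ θ₂)
        (FermiTensor.prodFunctional_prodGrading h₁ h₂)⟩⟩
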